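/- Let $q\ge 1$ and consider $n$ qudits of local dimension $q$ with starting state $|0\rangle^{\otimes n}$. A *parameterized gate* is a gate $W_l e^{-iA\theta}W_r$ acting on at most two qudits, where $A$ is Hermitian, $W_l,W_r$ are fixed unitaries acting on the same qudits, $\theta$ is one of $p$ real parameters, and $\theta\mapsto e^{-iA\theta}$ has period $2\pi$. A *hardware-efficient ansatz* $U(\theta)$, $\theta\in[0,2\pi]^p$, is a circuit of $m$ *entangling gates* $V_1,\dots,V_m$, the $t$-th acting on a pair of distinct qudits $\{i_t,j_t\}$ and being immediately preceded and succeeded by arbitrarily many parameterized gates, each acting on one or both of the qudits $i_t,j_t$; every qudit is acted on by at least one entangling gate. The entangling gates $V_1,\dots,V_m$ are independent, and each is distributed according to a probability measure on $\mathrm U(q^2)$ that is a unitary 2-design, i.e. for which $\mathbb E[V\otimes V\otimes\bar V\otimes\bar V]$ has the same value as under the Haar probability measure. Write $\mathbb E_V$ for the expectation over them and $\mathbb E_\theta$ for the expectation over $\theta$ uniform on $[0,2\pi]^p$. Let $M_0,\dots,M_{q^2-1}\in\mathbb C^{q\times q}$ satisfy $M_0=I$ and $\mathrm{tr}(M_i^\dagger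 M_j)=q\,\delta_{i,j}$. For $\mathbf x\in\{0,\dots,q^2-1\}^n$ let $M_{\mathbf x}=M_{\mathbf x_1}\otimes\dots\otimes M_{\mathbf x_n}$, $\mathrm{supp}(\mathbf x)=\{k:\mathbf x_k\ne 0\}$ and $$g_{\mathbf x}=\mathbb E_V\,\mathbb E_\theta\,\bigl|\langle 0^n|U(\theta)^\dagger M_{\mathbf x}U(\theta)|0^n\rangle\bigr|^2 .$$ Let $(\vec\Gamma^0,\dots,\vec\Gamma^m)$ be the following biased random walk on $\{\mathtt I,\mathtt S\}^n$. In $\vec\Gamma^0$ each site independently has label $\mathtt S$ with probability $1/(q+1)$ and label $\mathtt I$ otherwise. In step $t$, if the sites $i_t,j_t$ carry equal labels, nothing changes; if they carry different labels, both become $\mathtt S$ with probability $1/(q^2+1)$ and both become $\mathtt I$ otherwise. Let $\mathrm{supp}(\vec\Gamma^m)$ be the set of sites with label $\mathtt S$ in $\vec\Gamma^m$. Then $$g_{\mathbf x}=\Pr\bigl[\mathrm{supp}(\mathbf x)\subseteq\mathrm{supp}(\vec\Gamma^m)\bigr].$$ If moreover all $M_i$ are Hermitian, then also $\mathbb E_V\,\mathbb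 E_\theta\,\langle 0^n|U(\theta)^\dagger M_{\mathbf x}U(\theta)|0^n\rangle^2=\Pr[\mathrm{supp}(\mathbf x)\subseteq\mathrm{supp}(\vec\Gamma^m)]$. -/

import Mathlib

open MeasureTheory Matrix
open scoped ENNReal

noncomputable section

namespace HEA

/-! ### The unitary group, its normalized Haar measure, and unitary 2-designs -/

section Haar

variable {ι : Type*} [Fintype ι] [DecidableEq ι]

/-- The unitary group carries its Borel σ-algebra. -/
instance : MeasurableSpace (Matrix.unitaryGroup ι ℂ) := borel _

instance : BorelSpace (Matrix.unitaryGroup ι ℂ) := ⟨rfl⟩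

/-- The unitary group is compact: it is closed and has entries of modulus at most one. -/
instance : CompactSpace (Matrix.unitaryGroup ι ℂ) := by
  refine (isCompact_iff_compactSpace (s := (Matrix.unitaryGroup ι ℂ : Set (Matrix ι ι ℂ)))).mp ?_
  have hK : IsCompact (Set.pi Set.univ fun _ : ι => Set.pi Set.univ fun _ : ι =>
      Metric.closedBall (0 : ℂ) 1) :=
    isCompact_univ_pi fun _ => isCompact_univ_pi fun _ => isCompact_closedBall _ _
  refine IsCompact.of_isClosed_subset (s := (Set.pi Set.univ fun _ : ι =>
    Set.pi Set.univ fun _ : ι => Metric.closedBall (0 : ℂ) 1)) hK ?_ ?_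
  · have h : ((Matrix.unitaryGroup ι ℂ : Set (Matrix ι ι ℂ))) = {A | A * star A = 1} := by
      ext A
      exact Matrix.mem_unitaryGroup_iff
    rw [h]
    exact isClosed_eq (by fun_prop) continuous_const
  · intro A hA i _ j _
    simpa using entry_norm_bound_of_unitary hA i j

/-- The Haar probability measure on the unitary group. -/
def unitaryHaar (ι : Type*) [Fintype ι] [DecidableEq ι] : Measure (Matrix.unitaryGroup ι ℂ) :=
  Measure.haarMeasure ⊤

/-- `μ` is a unitary 2-design: its average of `V ⊗ V ⊗ conj V ⊗ conj V` is, entry by entry,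
the average under the Haar probability measure. -/
def IsTwoDesign (μ : Measure (Matrix.unitaryGroup ι ℂ)) : Prop :=
  ∀ a b c d a' b' c' d' : ι,
    ∫ V, V.1 a b * V.1 c d * star (V.1 a' b') * star (V.1 c' d') ∂μ =
      ∫ V, V.1 a b * V.1 c d * star (V.1 a' b') * star (V.1 c' d') ∂(unitaryHaar ι)

end Haar

/-! ### Operators on `n` qudits of dimension `q` -/

/-- Operators on two qudits. -/
abbrev PairOp (q : ℕ) := Matrix (Fin q × Fin q) (Fin q × Fin q) ℂ

/-- Operators on `n` qudits, in the computational basis indexed by strings in `[q]ⁿ`. -/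
abbrev Op (n q : ℕ) := Matrix (Fin n → Fin q) (Fin n → Fin q) ℂ

/-- The operator that acts as `A` on the ordered pair of sites `(i, j)` and as the identity on all
other sites. -/
def onPair {n q : ℕ} (i j : Fin n) (A : PairOp q) : Op n q :=
  Matrix.of fun s t => if ∀ k, k ≠ i → k ≠ j → s k = t k then A (s i, s j) (t i, t j) else 0

/-- The tensor product `B 0 ⊗ ⋯ ⊗ B (n - 1)` of one-site operators. -/
def tensor {n q : ℕ} (B : Fin n → Matrix (Fin q) (Fin q) ℂ) : Op n q :=
  Matrix.of fun s t => ∏ k, B k (s k) (t k)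

/-- `⟨0ⁿ| X |0ⁿ⟩`. -/
def zeroExpectation {n q : ℕ} [NeZero q] (X : Op n q) : ℂ := X (fun _ => 0) (fun _ => 0)

/-- The family `M` is an orthogonal basis of the `q × q` matrices for the Hilbert–Schmidt inner
product, with `M 0 = 1` and normalization `tr (Mᵢ† Mⱼ) = q δᵢⱼ`. -/
structure IsOperatorBasis {q : ℕ} [NeZero q] (M : Fin (q ^ 2) → Matrix (Fin q) (Fin q) ℂ) :
    Prop where
  zero : M 0 = 1
  trace : ∀ i j, ((M i)ᴴ * M j).trace = if i = j then (q : ℂ) else 0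

/-- The support of a string of basis labels. -/
def supp {n q : ℕ} [NeZero q] (x : Fin n → Fin (q ^ 2)) : Set (Fin n) := {k | x k ≠ 0}

/-! ### The circuit model -/

/-- A parameterized gate `W_l exp(-i A θ) W_r` on (at most) two qudits, `2π`-periodic in its
parameter `θ`, which is the coordinate `param` of the vector of the `p` parameters. -/
structure ParamGate (q p : ℕ) where
  A : PairOp q
  hermitian : A.IsHermitian
  Wl : Matrix.unitaryGroup (Fin q × Fin q) ℂ
  Wr : Matrix.unitaryGroup (Fin q × Fin q) ℂ
  param : Fin p
  periodic : Function.Periodic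
    (fun θ : ℝ => NormedSpace.exp ((-(Complex.I * (θ : ℂ))) • A)) (2 * Real.pi)

/-- The unitary of a parameterized gate. -/
def ParamGate.toOp {q p : ℕ} (G : ParamGate q p) (θ : Fin p → ℝ) : PairOp q :=
  G.Wl.1 * NormedSpace.exp ((-(Complex.I * (θ G.param : ℂ))) • G.A) * G.Wr.1

/-- The product of operators listed in the order of time: later ones stand to the left. -/
def timeOrdered {α : Type*} [Monoid α] (l : List α) : α := l.reverse.prod

/-- One entangling gate, on two distinct sites `i` and `j`, with the parameterized gates that
precede and succeed it; these act on one or both of the sites `i` and `j`. -/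
structure Block (n q p : ℕ) where
  i : Fin n
  j : Fin n
  ne : i ≠ j
  pre : List (ParamGate q p)
  post : List (ParamGate q p)

/-- The operator of a block, when the entangling gate is realized by `V`. -/
def Block.toOp {n q p : ℕ} (B : Block n q p) (V : Matrix.unitaryGroup (Fin q × Fin q) ℂ)
    (θ : Fin p → ℝ) : Op n q :=
  timeOrdered (B.post.map fun G => onPair B.i B.j (G.toOp θ)) *
    onPair B.i B.j V.1 *
    timeOrdered (B.pre.map fun G => onPair B.i B.j (G.toOp θ))

/-- A hardware-efficient ansatz on `n` qudits of dimension `q` with `p` parameters and `m`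
entangling gates, in which every qudit is acted on by some entangling gate. -/
structure Circuit (n q p m : ℕ) where
  block : Fin m → Block n q p
  covers : ∀ k : Fin n, ∃ t : Fin m, k = (block t).i ∨ k = (block t).j

/-- The unitary `U_V(θ)` for the realization `V` of the entangling gates. -/
def Circuit.toOp {n q p m : ℕ} (C : Circuit n q p m)
    (V : Fin m → Matrix.unitaryGroup (Fin q × Fin q) ℂ) (θ : Fin p → ℝ) : Op n q :=
  timeOrdered (List.ofFn fun t => (C.block t).toOp (V t) θ)

/-- The pairs of sites on which the successive entangling gates act; this is all that the circuit
without its parameterized gates retains for the random walk. -/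
def Circuit.pairs {n q p m : ℕ} (C : Circuit n q p m) (t : Fin m) : Fin n × Fin n :=
  ((C.block t).i, (C.block t).j)

/-- `⟨0ⁿ| U_V(θ)† X U_V(θ) |0ⁿ⟩`. -/
def Circuit.expval {n q p m : ℕ} [NeZero q] (C : Circuit n q p m) (X : Op n q)
    (V : Fin m → Matrix.unitaryGroup (Fin q × Fin q) ℂ) (θ : Fin p → ℝ) : ℂ :=
  zeroExpectation ((C.toOp V θ)ᴴ * X * C.toOp V θ)

/-- The uniform distribution on the feasible set `[0, 2π]ᵖ`. -/
def uniformParams (p : ℕ) : Measure (Fin p → ℝ) :=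
  ProbabilityTheory.cond volume (Set.Icc 0 fun _ => 2 * Real.pi)

/-- `E_V E_θ F(V, θ)`: the entangling gates are independent, the `t`-th one with law `μ t`, and
`θ` is uniform on `[0, 2π]ᵖ`. -/
def average {q p m : ℕ} {E : Type*} [NormedAddCommGroup E] [NormedSpace ℝ E]
    (μ : Fin m → Measure (Matrix.unitaryGroup (Fin q × Fin q) ℂ))
    (F : (Fin m → Matrix.unitaryGroup (Fin q × Fin q) ℂ) → (Fin p → ℝ) → E) : E :=
  ∫ V, ∫ θ, F V θ ∂(uniformParams p) ∂(Measure.pi μ)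

/-! ### The biased random walk -/

/-- The two labels. -/
inductive Label
  | I
  | S
  deriving DecidableEq

instance : Fintype Label := ⟨{Label.I, Label.S}, fun l => by cases l <;> simp⟩

/-- The law of a label which is `S` with probability `1 / (d + 1)` and `I` otherwise. -/
def labelLaw (d : ℕ) : PMF Label :=
  PMF.ofFintype (fun l => match l with
    | Label.S => 1 / ((d : ℝ≥0∞) + 1)
    | Label.I => (d : ℝ≥0∞) / ((d : ℝ≥0∞) + 1)) (by
    have h : (Finset.univ : Finset Label) = {Label.I, Label.S} := rfl
    rw [h, Finset.sum_pair (by decide), ENNReal.div_add_div_same]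
    exact ENNReal.div_self (by simp) (by simp))

/-- The law of the initial configuration: each site is independently `S` with probability
`1 / (q + 1)` and `I` otherwise. -/
def initialLaw (n q : ℕ) : PMF (Fin n → Label) :=
  PMF.ofFintype (fun c => ∏ k, labelLaw q (c k)) (by
    have h := Finset.prod_univ_sum (fun _ : Fin n => (Finset.univ : Finset Label))
      (fun _ l => labelLaw q l)
    rw [Fintype.piFinset_univ] at h
    rw [← h]
    have h1 : ∑ l, labelLaw q l = 1 := by
      rw [← tsum_fintype (L := .unconditional _)]
      exact (labelLaw q).tsum_coe
    simp [h1])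

/-- The action of a gate on the pair of sites `e`: equal labels are left unchanged; different
labels both become `S` with probability `1 / (q² + 1)` and both become `I` otherwise. -/
def gateStep {n : ℕ} (q : ℕ) (e : Fin n × Fin n) (c : Fin n → Label) : PMF (Fin n → Label) :=
  if c e.1 = c e.2 then PMF.pure c
  else (labelLaw (q ^ 2)).map fun l => Function.update (Function.update c e.1 l) e.2 l

/-- The law of the trajectory `(Γ⁰, …, Γᵐ)` of the biased random walk whose `t`-th gate acts on
the pair of sites `e t`. -/
def biasedWalk (n q : ℕ) : (m : ℕ) → (Fin m → Fin n × Fin n) → PMF (Fin (m + 1) → Fin n → Label)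
  | 0, _ => (initialLaw n q).map fun c _ => c
  | m + 1, e => (biasedWalk n q m fun t => e t.castSucc).bind fun γ =>
      (gateStep q (e (Fin.last m)) (γ (Fin.last m))).map fun c =>
        Fin.snoc (α := fun _ => Fin n → Label) γ c

/-- The set of sites with label `S`. -/
def sSites {n : ℕ} (c : Fin n → Label) : Set (Fin n) := {k | c k = Label.S}

/-- `Pr[supp x ⊆ supp Γᵐ]` in the biased random walk associated with the circuit. -/
def Circuit.walkProb {n q p m : ℕ} [NeZero q] (C : Circuit n q p m)
    (x : Fin n → Fin (q ^ 2)) : ℝ :=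
  ((biasedWalk n q m C.pairs).toOuterMeasure {γ | supp x ⊆ sSites (γ (Fin.last m))}).toReal

end HEA

end

/-!
The square of an expectation value is an expectation value in two copies of the system, where
`M_x` becomes the product over the sites of `M_{x_k} ⊗ M_{x_k}†`. In the Heisenberg picture, the
average over an entangling gate acting on `i, j` is the projection of `Y` onto the commutant of the
operators `W ⊗ W`, which is spanned by the identity and the swap of the copies; both are products
over the sites `i` and `j`, and both are fixed by the parameterized gates, so that these never
matter. The projection preserves `tr Y` and `tr (S Y)`, where `S` is the swap. Normalized to
`w_I Y = tr Y / d²` and `w_S Y = tr (S Y) / d`, they take the value `1` at the identity, and `1 / d`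
and `d` at the swap. Hence replacing `B_i ⊗ B_j` by its projection changes the product of the
`w_{c_k}(B_k)` over the sites into its mean over one step of the walk from the labels `c`, while
`⟨00| Y |00⟩` is the mean of `w_l Y` over an initial label `l` when `Y` is the identity or the swap.
Finally `w_I` vanishes and `w_S` is `1` at `M_i ⊗ M_i†` for `i ≠ 0`, so the product becomes the
indicator of `supp x ⊆ supp Γᵐ`.
-/

namespace HEA

open scoped Kronecker

/-! ### The swap operator and the commutant of `W ⊗ W` -/

section Swap

variable {R ι : Type*} [DecidableEq ι]

/-- The operator on two copies of a space that exchanges the copies. -/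
def swapMatrix (R ι : Type*) [DecidableEq ι] [Zero R] [One R] : Matrix (ι × ι) (ι × ι) R :=
  (1 : Matrix (ι × ι) (ι × ι) R).submatrix Prod.swap id

theorem swapMatrix_apply [Zero R] [One R] (s t : ι × ι) :
    swapMatrix R ι s t = if s.swap = t then 1 else 0 :=
  Matrix.one_apply

variable [Fintype ι]

theorem swapMatrix_mul [NonAssocSemiring R] (A : Matrix (ι × ι) (ι × ι) R) :
    swapMatrix R ι * A = A.submatrix Prod.swap id := by
  ext s t
  simp [Matrix.mul_apply, swapMatrix_apply]

theorem mul_swapMatrix [NonAssocSemiring R] (A : Matrix (ι × ι) (ι × ι) R) :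
    A * swapMatrix R ι = A.submatrix id Prod.swap := by
  ext s t
  simp [Matrix.mul_apply, swapMatrix_apply, Prod.swap_eq_iff_eq_swap]

theorem swapMatrix_mul_self [NonAssocSemiring R] : swapMatrix R ι * swapMatrix R ι = 1 := by
  rw [swapMatrix_mul, swapMatrix, Matrix.submatrix_submatrix, Prod.swap_swap_eq, Function.id_comp,
    Matrix.submatrix_id_id]

theorem trace_swapMatrix [NonAssocSemiring R] : (swapMatrix R ι).trace = Fintype.card ι := by
  have hdiag (x y : ι) : swapMatrix R ι (x, y) (x, y) = if x = y then 1 else 0 := by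
    simp [swapMatrix_apply, eq_comm (a := y)]
  simp only [Matrix.trace, Fintype.sum_prod_type, Matrix.diag_apply, hdiag]
  simp

theorem kronecker_mul_swapMatrix [CommSemiring R] (A B : Matrix ι ι R) :
    (A ⊗ₖ B) * swapMatrix R ι = swapMatrix R ι * (B ⊗ₖ A) := by
  rw [mul_swapMatrix, swapMatrix_mul]
  ext s t
  simp [mul_comm]

theorem trace_swapMatrix_mul_kronecker [NonAssocSemiring R] (A B : Matrix ι ι R) :
    (swapMatrix R ι * (A ⊗ₖ B)).trace = (A * B).trace := by
  rw [swapMatrix_mul, Matrix.trace, Fintype.sum_prod_type, Finset.sum_comm]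
  simp only [Matrix.trace, Matrix.diag_apply, Matrix.mul_apply, Matrix.submatrix_apply,
    Prod.swap_prod_mk, id_eq, Matrix.kroneckerMap_apply]

end Swap

section Commutant

variable {ι : Type*} [Fintype ι] [DecidableEq ι]

theorem diagonal_mulSingle_I_mem_unitaryGroup (a : ι) :
    Matrix.diagonal (Pi.mulSingle a Complex.I) ∈ Matrix.unitaryGroup ι ℂ := by
  rw [Matrix.mem_unitaryGroup_iff, Matrix.star_eq_conjTranspose, Matrix.diagonal_conjTranspose,
    Matrix.diagonal_mul_diagonal, ← Matrix.diagonal_one]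
  congr 1
  funext k
  by_cases h : k = a <;> simp [h]

theorem permMatrix_mem_unitaryGroup {R : Type*} [CommRing R] [StarRing R] (σ : Equiv.Perm ι) :
    σ.permMatrix R ∈ Matrix.unitaryGroup ι R := by
  rw [Matrix.mem_unitaryGroup_iff, Matrix.star_eq_conjTranspose, Matrix.conjTranspose_permMatrix,
    ← Matrix.permMatrix_mul, inv_mul_cancel, Matrix.permMatrix_one]

theorem exists_mem_unitaryGroup_apply_mul_apply_ne_zero {a b : ι} (hab : a ≠ b) :
    ∃ W ∈ Matrix.unitaryGroup ι ℂ, W a a * W a b ≠ 0 := by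
  set P := (Equiv.swap a b).permMatrix ℂ with hP
  have hPstar : star P = P := by
    rw [Matrix.star_eq_conjTranspose, hP, Matrix.conjTranspose_permMatrix, Equiv.swap_inv]
  have hPmul : P * P = 1 := by
    rw [hP, ← Matrix.permMatrix_mul, Equiv.swap_mul_self, Matrix.permMatrix_one]
  refine ⟨(3 / 5 : ℂ) • 1 + (4 / 5 * Complex.I) • P, ?_, ?_⟩
  · rw [Matrix.mem_unitaryGroup_iff, star_add, star_smul, star_smul, star_one, hPstar]
    simp only [add_mul, mul_add, smul_mul_smul_comm, mul_one, one_mul, hPmul]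
    ext s t
    simp
    ring_nf
    simp
    ring
  · simp [hP, Equiv.Perm.permMatrix, PEquiv.toMatrix_apply, hab, hab.symm]

variable {Z : Matrix (ι × ι) (ι × ι) ℂ}

theorem eq_or_eq_swap_of_commute_kronecker_self
    (hZ : ∀ W ∈ Matrix.unitaryGroup ι ℂ, Commute (W ⊗ₖ W) Z) {s t : ι × ι} (h : Z s t ≠ 0) :
    t = s ∨ t = s.swap := by
  have phase_eq (a : ι) : (Pi.mulSingle a Complex.I : ι → ℂ) s.1 *
      (Pi.mulSingle a Complex.I : ι → ℂ) s.2 =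
      (Pi.mulSingle a Complex.I : ι → ℂ) t.1 * (Pi.mulSingle a Complex.I : ι → ℂ) t.2 := by
    have h1 := congrFun₂ (hZ _ (diagonal_mulSingle_I_mem_unitaryGroup a)).eq s t
    rw [Matrix.diagonal_kronecker_diagonal, Matrix.diagonal_mul, Matrix.mul_diagonal,
      mul_comm] at h1
    exact mul_left_cancel₀ h h1
  obtain ⟨x, x'⟩ := s
  obtain ⟨y, y'⟩ := t
  have hx := phase_eq x
  have hx' := phase_eq x'
  simp only [Pi.mulSingle_apply, Prod.swap_prod_mk, Prod.mk.injEq] at hx hx' ⊢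
  have hI : Complex.I ≠ 1 := fun h => by simpa using congrArg Complex.re h
  have hII := Complex.I_mul_I
  have : (-1 : ℂ) ≠ 1 := by norm_num
  have : (-1 : ℂ) ≠ Complex.I := fun h => by simpa using congrArg Complex.re h
  grind

theorem apply_perm_of_commute_kronecker_self
    (hZ : ∀ W ∈ Matrix.unitaryGroup ι ℂ, Commute (W ⊗ₖ W) Z) (σ : Equiv.Perm ι)
    (s t : ι × ι) : Z (s.map σ σ) (t.map σ σ) = Z s t := by
  obtain ⟨x, x'⟩ := s
  obtain ⟨y, y'⟩ := t
  have h := congrFun₂ (hZ _ (permMatrix_mem_unitaryGroup σ)).eq (x, x') (σ y, σ y')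
  simpa [Matrix.mul_apply, Fintype.sum_prod_type, Equiv.Perm.permMatrix, PEquiv.toMatrix_apply,
    Equiv.toPEquiv_apply, ite_and] using h

theorem apply_eq_apply_of_commute_kronecker_self
    (hZ : ∀ W ∈ Matrix.unitaryGroup ι ℂ, Commute (W ⊗ₖ W) Z) {a b x y : ι} (hab : a ≠ b)
    (hxy : x ≠ y) : Z (x, y) (x, y) = Z (a, b) (a, b) ∧ Z (x, y) (y, x) = Z (a, b) (b, a) := by
  have := Equiv.Perm.isMultiplyPretransitive ι 2
  obtain ⟨σ, rfl, rfl⟩ := MulAction.is_two_pretransitive_iff.mp this hab hxy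
  exact ⟨apply_perm_of_commute_kronecker_self hZ σ (a, b) (a, b),
    apply_perm_of_commute_kronecker_self hZ σ (a, b) (b, a)⟩

theorem apply_self_of_commute_kronecker_self
    (hZ : ∀ W ∈ Matrix.unitaryGroup ι ℂ, Commute (W ⊗ₖ W) Z) {a b : ι} (hab : a ≠ b) :
    Z (a, a) (a, a) = Z (a, b) (a, b) + Z (a, b) (b, a) := by
  obtain ⟨W, hW, hne⟩ := exists_mem_unitaryGroup_apply_mul_apply_ne_zero hab
  have hleft : ((W ⊗ₖ W) * Z) (a, a) (a, b) =
      W a a * W a b * (Z (a, b) (a, b) + Z (a, b) (b, a)) := by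
    rw [Matrix.mul_apply, Fintype.sum_eq_add (a, b) (b, a) (by simp [hab]),
      (apply_eq_apply_of_commute_kronecker_self hZ hab hab.symm).2]
    · simp only [Matrix.kroneckerMap_apply]
      ring
    · rintro t ⟨h1, h2⟩
      by_contra hne
      obtain h | h := eq_or_eq_swap_of_commute_kronecker_self hZ (right_ne_zero_of_mul hne)
      · exact h1 h.symm
      · exact h2 (Prod.swap_eq_iff_eq_swap.mp h.symm)
  have hright : (Z * (W ⊗ₖ W)) (a, a) (a, b) = Z (a, a) (a, a) * (W a a * W a b) := by
    rw [Matrix.mul_apply, Fintype.sum_eq_single (a, a)]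
    · rfl
    · intro t ht
      by_contra hne
      obtain h | h := eq_or_eq_swap_of_commute_kronecker_self hZ (left_ne_zero_of_mul hne) <;>
        exact ht h
  have h := congrFun₂ (hZ W hW).eq (a, a) (a, b)
  rw [hleft, hright, mul_comm] at h
  exact (mul_right_cancel₀ hne h).symm

theorem exists_eq_smul_one_add_smul_swapMatrix
    (hZ : ∀ W ∈ Matrix.unitaryGroup ι ℂ, Commute (W ⊗ₖ W) Z) :
    ∃ α β : ℂ, Z = α • 1 + β • swapMatrix ℂ ι := by
  rcases subsingleton_or_nontrivial ι with hι | hι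
  · rcases isEmpty_or_nonempty ι with he | ⟨⟨a⟩⟩
    · exact ⟨0, 0, Subsingleton.elim _ _⟩
    · refine ⟨Z (a, a) (a, a), 0, ?_⟩
      ext s t
      rw [Subsingleton.elim s (a, a), Subsingleton.elim t (a, a)]
      simp
  · obtain ⟨a, b, hab⟩ := exists_pair_ne ι
    refine ⟨Z (a, b) (a, b), Z (a, b) (b, a), ?_⟩
    ext ⟨x, y⟩ t
    simp only [Matrix.add_apply, Matrix.smul_apply, Matrix.one_apply, swapMatrix_apply,
      Prod.swap_prod_mk, smul_eq_mul, mul_ite, mul_one, mul_zero]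
    by_cases ht : t = (x, y) ∨ t = (y, x)
    · by_cases hxy : x = y
      · subst hxy
        obtain ⟨w, hw⟩ := exists_ne x
        obtain ⟨h1, h2⟩ := apply_eq_apply_of_commute_kronecker_self hZ hab hw.symm
        obtain rfl : t = (x, x) := ht.elim id id
        rw [apply_self_of_commute_kronecker_self hZ hw.symm, h1, h2, if_pos rfl, if_pos rfl]
      · obtain ⟨h1, h2⟩ := apply_eq_apply_of_commute_kronecker_self hZ hab hxy
        rcases ht with rfl | rfl
        · simp [h1, hxy, Ne.symm hxy]
        · simp [h2, hxy]
    · have h0 : Z (x, y) t = 0 := by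
        by_contra h
        exact ht (eq_or_eq_swap_of_commute_kronecker_self hZ h)
      rw [not_or] at ht
      rw [h0, if_neg (Ne.symm ht.1), if_neg (Ne.symm ht.2), add_zero]

end Commutant

/-! ### Operators on two copies of a space -/

section TwoCopies

/-- The operators on two copies of a space with basis `ι`. Two copies are needed because the square
of the expectation of `X` is an expectation of `X ⊗ X`. -/
abbrev CopyOp (ι : Type*) := Matrix (ι × ι) (ι × ι) ℂ

variable {ι κ : Type*}

/-- The tensor product of an operator on two copies of `ι` and one on two copies of `κ`, as an
operator on two copies of `ι × κ`: the four factors come in the order `ι, κ, ι, κ`. -/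
noncomputable def kroneckerCopies : CopyOp ι →ₗ[ℂ] CopyOp κ →ₗ[ℂ] CopyOp (ι × κ) :=
  (Matrix.kroneckerBilinear (R := ℂ) (α := ℂ)).compr₂ (Matrix.reindexLinearEquiv ℂ ℂ
    (Equiv.prodProdProdComm ι ι κ κ) (Equiv.prodProdProdComm ι ι κ κ)).toLinearMap

theorem kroneckerCopies_apply (Y : CopyOp ι) (R : CopyOp κ) (s t : (ι × κ) × (ι × κ)) :
    kroneckerCopies Y R s t =
      Y (s.1.1, s.2.1) (t.1.1, t.2.1) * R (s.1.2, s.2.2) (t.1.2, t.2.2) :=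
  rfl

theorem kroneckerCopies_eq_submatrix (Y : CopyOp ι) (R : CopyOp κ) :
    kroneckerCopies Y R = (Y ⊗ₖ R).submatrix (Equiv.prodProdProdComm ι κ ι κ)
      (Equiv.prodProdProdComm ι κ ι κ) :=
  rfl

theorem kroneckerCopies_kronecker (A B : Matrix ι ι ℂ) (C D : Matrix κ κ ℂ) :
    kroneckerCopies (A ⊗ₖ B) (C ⊗ₖ D) = (A ⊗ₖ C) ⊗ₖ (B ⊗ₖ D) := by
  ext s t
  simp only [kroneckerCopies_apply, Matrix.kroneckerMap_apply]
  ring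

theorem conjTranspose_kroneckerCopies (Y : CopyOp ι) (R : CopyOp κ) :
    (kroneckerCopies Y R)ᴴ = kroneckerCopies Yᴴ Rᴴ := by
  rw [kroneckerCopies_eq_submatrix, Matrix.conjTranspose_submatrix, Matrix.conjTranspose_kronecker,
    kroneckerCopies_eq_submatrix]

theorem kroneckerCopies_one [DecidableEq ι] [DecidableEq κ] :
    kroneckerCopies (1 : CopyOp ι) (1 : CopyOp κ) = 1 := by
  rw [kroneckerCopies_eq_submatrix, Matrix.one_kronecker_one, Matrix.submatrix_one_equiv]

theorem kroneckerCopies_swapMatrix [DecidableEq ι] [DecidableEq κ] :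
    kroneckerCopies (swapMatrix ℂ ι) (swapMatrix ℂ κ) = swapMatrix ℂ (ι × κ) := by
  ext ⟨⟨a, b⟩, ⟨c, d⟩⟩ ⟨⟨a', b'⟩, ⟨c', d'⟩⟩
  simp only [kroneckerCopies_apply, swapMatrix_apply, Prod.swap_prod_mk, Prod.mk.injEq, mul_ite,
    mul_one, mul_zero, ← ite_and]
  congr 1
  grind

/-- The operator on two copies of `κ` that corresponds to `Y` under a relabelling of the basis. -/
def reindexCopies (e : κ ≃ ι) : CopyOp ι →ₗ[ℂ] CopyOp κ :=
  (Matrix.reindexLinearEquiv ℂ ℂ (e.symm.prodCongr e.symm) (e.symm.prodCongr e.symm)).toLinearMap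

theorem reindexCopies_eq_submatrix (e : κ ≃ ι) (Y : CopyOp ι) :
    reindexCopies e Y = Y.submatrix (e.prodCongr e) (e.prodCongr e) :=
  rfl

variable [Fintype ι] [Fintype κ]

theorem kroneckerCopies_mul_kroneckerCopies (Y Y' : CopyOp ι) (R R' : CopyOp κ) :
    kroneckerCopies Y R * kroneckerCopies Y' R' = kroneckerCopies (Y * Y') (R * R') := by
  simp only [kroneckerCopies_eq_submatrix, Matrix.submatrix_mul_equiv, Matrix.mul_kronecker_mul]

theorem trace_kroneckerCopies (Y : CopyOp ι) (R : CopyOp κ) :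
    (kroneckerCopies Y R).trace = Y.trace * R.trace := by
  rw [← Matrix.trace_kronecker]
  exact (Equiv.prodProdProdComm ι κ ι κ).sum_comp fun s => (Y ⊗ₖ R) s s

/-- The Heisenberg evolution `Y ↦ (U ⊗ U)† Y (U ⊗ U)` on two copies. -/
noncomputable def conjCopies (U : Matrix ι ι ℂ) : CopyOp ι →ₗ[ℂ] CopyOp ι :=
  LinearMap.mulRight ℂ (U ⊗ₖ U) ∘ₗ LinearMap.mulLeft ℂ (U ⊗ₖ U)ᴴ

theorem conjCopies_apply (U : Matrix ι ι ℂ) (Y : CopyOp ι) :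
    conjCopies U Y = (U ⊗ₖ U)ᴴ * Y * (U ⊗ₖ U) :=
  rfl

theorem conjCopies_one_apply [DecidableEq ι] (Y : CopyOp ι) : conjCopies 1 Y = Y := by
  rw [conjCopies_apply, Matrix.one_kronecker_one, Matrix.conjTranspose_one, one_mul, mul_one]

theorem conjCopies_mul (A B : Matrix ι ι ℂ) (Y : CopyOp ι) :
    conjCopies (A * B) Y = conjCopies B (conjCopies A Y) := by
  simp only [conjCopies_apply, Matrix.mul_kronecker_mul, Matrix.conjTranspose_mul, Matrix.mul_assoc]

theorem conjCopies_kronecker (U A B : Matrix ι ι ℂ) :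
    conjCopies U (A ⊗ₖ B) = (Uᴴ * A * U) ⊗ₖ (Uᴴ * B * U) := by
  simp only [conjCopies_apply, Matrix.mul_kronecker_mul, Matrix.conjTranspose_kronecker]

theorem conjCopies_kroneckerCopies (A : Matrix ι ι ℂ) (C : Matrix κ κ ℂ) (Y : CopyOp ι)
    (R : CopyOp κ) :
    conjCopies (A ⊗ₖ C) (kroneckerCopies Y R) =
      kroneckerCopies (conjCopies A Y) (conjCopies C R) := by
  simp only [conjCopies_apply, ← kroneckerCopies_kronecker, conjTranspose_kroneckerCopies,
    kroneckerCopies_mul_kroneckerCopies]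

theorem conjCopies_submatrix (e : κ ≃ ι) (A : Matrix ι ι ℂ) (Y : CopyOp ι) :
    conjCopies (A.submatrix e e) (reindexCopies e Y) = reindexCopies e (conjCopies A Y) := by
  have hA : A.submatrix e e ⊗ₖ A.submatrix e e =
      (A ⊗ₖ A).submatrix (e.prodCongr e) (e.prodCongr e) := rfl
  simp only [conjCopies_apply, hA, reindexCopies_eq_submatrix, Matrix.conjTranspose_submatrix,
    Matrix.submatrix_mul_equiv]

theorem continuous_conjCopies (Y : CopyOp ι) : Continuous fun U => conjCopies U Y := by
  have h : Continuous fun U : Matrix ι ι ℂ => U ⊗ₖ U :=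
    continuous_matrix fun s t => by simp only [Matrix.kroneckerMap_apply]; fun_prop
  exact (h.matrix_conjTranspose.matrix_mul continuous_const).matrix_mul h

variable [DecidableEq ι] {U : Matrix ι ι ℂ}

theorem kronecker_self_mul_conjTranspose (hU : U ∈ Matrix.unitaryGroup ι ℂ) :
    (U ⊗ₖ U) * (U ⊗ₖ U)ᴴ = 1 :=
  Matrix.mem_unitaryGroup_iff.mp (Matrix.kronecker_mem_unitary hU hU)

theorem conjCopies_one (hU : U ∈ Matrix.unitaryGroup ι ℂ) : conjCopies U 1 = 1 := by
  rw [conjCopies_apply, mul_one]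
  exact Matrix.mem_unitaryGroup_iff'.mp (Matrix.kronecker_mem_unitary hU hU)

theorem trace_conjCopies (hU : U ∈ Matrix.unitaryGroup ι ℂ) (Y : CopyOp ι) :
    (conjCopies U Y).trace = Y.trace := by
  rw [conjCopies_apply, Matrix.trace_mul_cycle, kronecker_self_mul_conjTranspose hU, one_mul]

theorem swapMatrix_mul_conjCopies (U : Matrix ι ι ℂ) (Y : CopyOp ι) :
    swapMatrix ℂ ι * conjCopies U Y = conjCopies U (swapMatrix ℂ ι * Y) := by
  simp only [conjCopies_apply, Matrix.conjTranspose_kronecker, ← mul_assoc,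
    kronecker_mul_swapMatrix]

theorem conjCopies_swapMatrix (hU : U ∈ Matrix.unitaryGroup ι ℂ) :
    conjCopies U (swapMatrix ℂ ι) = swapMatrix ℂ ι := by
  rw [← mul_one (swapMatrix ℂ ι), ← swapMatrix_mul_conjCopies, conjCopies_one hU]

theorem commute_kronecker_self_of_conjCopies_eq (hU : U ∈ Matrix.unitaryGroup ι ℂ) {Y : CopyOp ι}
    (hY : conjCopies U Y = Y) : Commute (U ⊗ₖ U) Y := by
  rw [commute_iff_eq]
  conv_lhs => rw [← hY, conjCopies_apply, ← mul_assoc, ← mul_assoc,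
    kronecker_self_mul_conjTranspose hU, one_mul]

end TwoCopies

section LabelWeight

variable {ι κ : Type*} [Fintype ι] [DecidableEq ι] [Fintype κ] [DecidableEq κ]

/-- The weight with which an operator on two copies of a space of dimension `d` contributes to a
label of the random walk: `tr Y / d²` for `I`, and `tr (S Y) / d` with the swap `S` for `S`. -/
noncomputable def labelWeight : Label → CopyOp ι →ₗ[ℂ] ℂ
  | .I => ((Fintype.card ι : ℂ) ^ 2)⁻¹ • Matrix.traceLinearMap _ ℂ ℂ
  | .S => (Fintype.card ι : ℂ)⁻¹ •
      (Matrix.traceLinearMap _ ℂ ℂ ∘ₗ LinearMap.mulLeft ℂ (swapMatrix ℂ ι))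

theorem labelWeight_I (Y : CopyOp ι) :
    labelWeight .I Y = ((Fintype.card ι : ℂ) ^ 2)⁻¹ * Y.trace :=
  rfl

theorem labelWeight_S (Y : CopyOp ι) :
    labelWeight .S Y = (Fintype.card ι : ℂ)⁻¹ * (swapMatrix ℂ ι * Y).trace :=
  rfl

theorem labelWeight_conjCopies {U : Matrix ι ι ℂ} (hU : U ∈ Matrix.unitaryGroup ι ℂ) (l : Label)
    (Y : CopyOp ι) : labelWeight l (conjCopies U Y) = labelWeight l Y := by
  cases l
  · rw [labelWeight_I, labelWeight_I, trace_conjCopies hU]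
  · rw [labelWeight_S, labelWeight_S, swapMatrix_mul_conjCopies, trace_conjCopies hU]

theorem labelWeight_kroneckerCopies (l : Label) (Y : CopyOp ι) (R : CopyOp κ) :
    labelWeight l (kroneckerCopies Y R) = labelWeight l Y * labelWeight l R := by
  cases l
  · simp only [labelWeight_I, trace_kroneckerCopies, Fintype.card_prod, Nat.cast_mul, mul_pow,
      mul_inv]
    ring
  · simp only [labelWeight_S, ← kroneckerCopies_swapMatrix, kroneckerCopies_mul_kroneckerCopies,
      trace_kroneckerCopies, Fintype.card_prod, Nat.cast_mul, mul_inv]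
    ring

variable [Nonempty ι]

theorem labelWeight_one (l : Label) : labelWeight l (1 : CopyOp ι) = 1 := by
  cases l
  · rw [labelWeight_I, Matrix.trace_one, Fintype.card_prod, Nat.cast_mul, ← sq]
    exact inv_mul_cancel₀ (by simp)
  · rw [labelWeight_S, mul_one, trace_swapMatrix]
    exact inv_mul_cancel₀ (by simp)

theorem labelWeight_I_swapMatrix :
    labelWeight .I (swapMatrix ℂ ι) = (Fintype.card ι : ℂ)⁻¹ := by
  have hd : (Fintype.card ι : ℂ) ≠ 0 := by simp
  rw [labelWeight_I, trace_swapMatrix]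
  field_simp

theorem labelWeight_S_swapMatrix : labelWeight .S (swapMatrix ℂ ι) = Fintype.card ι := by
  have hd : (Fintype.card ι : ℂ) ≠ 0 := by simp
  rw [labelWeight_S, swapMatrix_mul_self, Matrix.trace_one, Fintype.card_prod, Nat.cast_mul]
  field_simp

end LabelWeight

/-! ### Averages over 2-designs -/

section Twirl

variable {ι : Type*} [Fintype ι] [DecidableEq ι]

instance : SecondCountableTopology (Matrix.unitaryGroup ι ℂ) :=
  have : SecondCountableTopology (Matrix ι ι ℂ) :=
    inferInstanceAs (SecondCountableTopology (ι → ι → ℂ))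
  inferInstanceAs (SecondCountableTopology
    ((Matrix.unitaryGroup ι ℂ : Set (Matrix ι ι ℂ)) : Type _))

instance : (unitaryHaar ι).IsHaarMeasure := by
  unfold unitaryHaar
  infer_instance

instance : IsProbabilityMeasure (unitaryHaar ι) :=
  ⟨Measure.haarMeasure_self (K₀ := ⊤)⟩

instance : (unitaryHaar ι).IsMulRightInvariant where
  map_mul_right_eq_self g := by
    have : IsProbabilityMeasure ((unitaryHaar ι).map (· * g)) :=
      Measure.isProbabilityMeasure_map (measurable_mul_const g).aemeasurable
    exact Measure.isHaarMeasure_eq_of_isProbabilityMeasure _ _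

theorem integrable_of_continuous {X E : Type*} [TopologicalSpace X] [CompactSpace X]
    [MeasurableSpace X] [OpensMeasurableSpace X] [NormedAddCommGroup E] (ν : Measure X)
    [IsFiniteMeasureOnCompacts ν] {f : X → E} (hf : Continuous f) : Integrable f ν :=
  hf.integrable_of_hasCompactSupport (HasCompactSupport.of_compactSpace f)

theorem continuous_conjCopies_coe (Y : CopyOp ι) :
    Continuous fun V : Matrix.unitaryGroup ι ℂ => conjCopies V.1 Y :=
  (continuous_conjCopies Y).comp continuous_subtype_val

open scoped Matrix.Norms.Elementwise

/-- The second-moment operator of a random unitary with law `μ`: the mean of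
`(V ⊗ V)† Y (V ⊗ V)`. -/
noncomputable def twirl (μ : Measure (Matrix.unitaryGroup ι ℂ)) (Y : CopyOp ι) : CopyOp ι :=
  ∫ V, conjCopies V.1 Y ∂μ

theorem linearMap_twirl (μ : Measure (Matrix.unitaryGroup ι ℂ)) [IsFiniteMeasure μ] {E : Type*}
    [NormedAddCommGroup E] [NormedSpace ℂ E] [CompleteSpace E] (L : CopyOp ι →ₗ[ℂ] E)
    (Y : CopyOp ι) : L (twirl μ Y) = ∫ V, L (conjCopies V.1 Y) ∂μ :=
  (L.toContinuousLinearMap.integral_comp_comm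
    (integrable_of_continuous μ (continuous_conjCopies_coe Y))).symm

theorem twirl_sum (μ : Measure (Matrix.unitaryGroup ι ℂ)) [IsFiniteMeasure μ] {κ : Type*}
    (T : Finset κ) (Y : κ → CopyOp ι) : twirl μ (∑ k ∈ T, Y k) = ∑ k ∈ T, twirl μ (Y k) := by
  simp only [twirl, map_sum]
  exact integral_finsetSum _ fun k _ =>
    integrable_of_continuous μ (continuous_conjCopies_coe (Y k))

theorem labelWeight_twirl (μ : Measure (Matrix.unitaryGroup ι ℂ)) [IsProbabilityMeasure μ]
    (l : Label) (Y : CopyOp ι) : labelWeight l (twirl μ Y) = labelWeight l Y := by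
  simp only [linearMap_twirl, labelWeight_conjCopies (SetLike.coe_mem _), integral_const,
    probReal_univ, one_smul]

theorem conjCopies_twirl_unitaryHaar {W : Matrix ι ι ℂ} (hW : W ∈ Matrix.unitaryGroup ι ℂ)
    (Y : CopyOp ι) : conjCopies W (twirl (unitaryHaar ι) Y) = twirl (unitaryHaar ι) Y := by
  simp only [linearMap_twirl, ← conjCopies_mul]
  exact integral_mul_right_eq_self (μ := unitaryHaar ι) (fun V => conjCopies V.1 Y) ⟨W, hW⟩

theorem conjCopies_single_apply (U : Matrix ι ι ℂ) (x y s t : ι × ι) (c : ℂ) :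
    conjCopies U (Matrix.single x y c) s t =
      c * (U y.1 t.1 * U y.2 t.2 * star (U x.1 s.1) * star (U x.2 s.2)) := by
  rw [conjCopies_apply, Matrix.mul_apply, Fintype.sum_eq_single y]
  · simp only [Matrix.mul_single_apply_same, Matrix.conjTranspose_apply, Matrix.kroneckerMap_apply,
      star_mul']
    ring
  · intro z hz
    rw [Matrix.mul_single_apply_of_ne _ _ _ _ _ hz, zero_mul]

theorem IsTwoDesign.twirl_eq {μ : Measure (Matrix.unitaryGroup ι ℂ)} [IsProbabilityMeasure μ]
    (hμ : IsTwoDesign μ) (Y : CopyOp ι) : twirl μ Y = twirl (unitaryHaar ι) Y := by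
  have twirl_single_apply (ν : Measure (Matrix.unitaryGroup ι ℂ)) [IsProbabilityMeasure ν]
      (x y s t : ι × ι) (c : ℂ) : twirl ν (Matrix.single x y c) s t =
        c * ∫ V, V.1 y.1 t.1 * V.1 y.2 t.2 * star (V.1 x.1 s.1) * star (V.1 x.2 s.2) ∂ν := by
    refine (linearMap_twirl ν (Matrix.entryLinearMap ℂ ℂ s t) _).trans ?_
    simp only [Matrix.entryLinearMap_apply, conjCopies_single_apply, integral_const_mul]
  rw [Matrix.matrix_eq_sum_single Y]
  simp only [twirl_sum]
  refine Finset.sum_congr rfl fun x _ => Finset.sum_congr rfl fun y _ => ?_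
  ext s t
  rw [twirl_single_apply, twirl_single_apply, hμ]

theorem IsTwoDesign.exists_twirl_eq {μ : Measure (Matrix.unitaryGroup ι ℂ)}
    [IsProbabilityMeasure μ] (hμ : IsTwoDesign μ) (Y : CopyOp ι) :
    ∃ α β : ℂ, twirl μ Y = α • 1 + β • swapMatrix ℂ ι := by
  rw [hμ.twirl_eq]
  exact exists_eq_smul_one_add_smul_swapMatrix fun W hW =>
    commute_kronecker_self_of_conjCopies_eq hW (conjCopies_twirl_unitaryHaar hW Y)

end Twirl

/-! ### Gates on a pair of sites -/

section Pair

variable {κ ι α : Type*} {n q : ℕ}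

/-- The product of the operators `B k`, each of which acts on the two copies of the site `k`. -/
def tensorCopies [Fintype κ] (B : κ → CopyOp ι) : CopyOp (κ → ι) :=
  Matrix.of fun s t => ∏ k, B k (s.1 k, s.2 k) (t.1 k, t.2 k)

theorem tensorCopies_apply [Fintype κ] (B : κ → CopyOp ι) (s t : (κ → ι) × (κ → ι)) :
    tensorCopies B s t = ∏ k, B k (s.1 k, s.2 k) (t.1 k, t.2 k) :=
  rfl

theorem tensor_kronecker_tensor (X Y : Fin n → Matrix (Fin q) (Fin q) ℂ) :
    tensor X ⊗ₖ tensor Y = tensorCopies fun k => X k ⊗ₖ Y k := by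
  ext s t
  simp only [Matrix.kroneckerMap_apply, tensor, tensorCopies, Matrix.of_apply,
    Finset.prod_mul_distrib]

theorem conjTranspose_tensor (B : Fin n → Matrix (Fin q) (Fin q) ℂ) :
    (tensor B)ᴴ = tensor fun k => (B k)ᴴ := by
  ext s t
  simp only [tensor, Matrix.conjTranspose_apply, Matrix.of_apply, star_prod]

/-- The sites other than `i` and `j`. -/
abbrev OtherSites (i j : κ) := {k : κ // k ≠ i ∧ k ≠ j}

variable [DecidableEq κ] {i j : κ}

/-- Separation of the values at the sites `i` and `j` from those at the other ones. -/
def splitPair (h : i ≠ j) : (κ → α) ≃ (α × α) × (OtherSites i j → α) where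
  toFun s := ((s i, s j), fun k => s k)
  invFun r k := if hi : k = i then r.1.1 else if hj : k = j then r.1.2 else r.2 ⟨k, hi, hj⟩
  left_inv s := by
    funext k
    dsimp only
    split_ifs with hi hj
    exacts [hi ▸ rfl, hj ▸ rfl, rfl]
  right_inv r := by
    ext k
    · simp
    · simp [h.symm]
    · simp [k.2.1, k.2.2]

theorem prod_eq_mul_mul_prod_otherSites [Fintype κ] {R : Type*} [CommMonoid R] (h : i ≠ j)
    (f : κ → R) : ∏ k, f k = f i * f j * ∏ k : OtherSites i j, f k := by
  have hpair : Finset.univ.filter (fun k => ¬(k ≠ i ∧ k ≠ j)) = {i, j} := by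
    ext k
    simp [or_iff_not_imp_left]
  rw [← Finset.prod_subtype (Finset.univ.filter fun k => k ≠ i ∧ k ≠ j) (by simp) f,
    ← Finset.prod_filter_not_mul_prod_filter Finset.univ fun k => k ≠ i ∧ k ≠ j, hpair,
    Finset.prod_pair h]

/-- Replacement of the values of `B` at the sites `i` and `j` by `D`. -/
def setPair (i j : κ) (B : κ → α) (D : α) : κ → α :=
  Function.update (Function.update B i D) j D

theorem setPair_left (i j : κ) (B : κ → α) (D : α) : setPair i j B D i = D := by
  simp [setPair, Function.update_apply]

theorem setPair_right (i j : κ) (B : κ → α) (D : α) : setPair i j B D j = D := by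
  simp [setPair]

theorem setPair_otherSites (B : κ → α) (D : α) (k : OtherSites i j) :
    setPair i j B D k = B k := by
  simp [setPair, k.2.1, k.2.2]

theorem prod_setPair [Fintype κ] {β R : Type*} [CommMonoid R] (h : i ≠ j) (f : κ → α → β → R)
    (B : κ → α) (D : α) (c : κ → β) :
    ∏ k, f k (setPair i j B D k) (c k) =
      f i D (c i) * f j D (c j) * ∏ k : OtherSites i j, f k (B k) (c k) := by
  simp only [prod_eq_mul_mul_prod_otherSites h, setPair_left, setPair_right, setPair_otherSites]

/-- Extension of an operator on two copies of the sites `i` and `j` by the operators `B k` on the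
two copies of the other sites. -/
noncomputable def extendCopies [Fintype κ] (h : i ≠ j) (B : κ → CopyOp ι) :
    CopyOp (ι × ι) →ₗ[ℂ] CopyOp (κ → ι) :=
  reindexCopies (splitPair h) ∘ₗ kroneckerCopies.flip (tensorCopies fun k : OtherSites i j => B k)

theorem extendCopies_apply [Fintype κ] (h : i ≠ j) (B : κ → CopyOp ι) (Y : CopyOp (ι × ι)) :
    extendCopies h B Y = reindexCopies (splitPair h)
      (kroneckerCopies Y (tensorCopies fun k : OtherSites i j => B k)) :=
  rfl

theorem extendCopies_setPair [Fintype κ] (h : i ≠ j) (B : κ → CopyOp ι) (D : CopyOp ι) :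
    extendCopies h (setPair i j B D) = extendCopies h B := by
  simp only [extendCopies, setPair_otherSites]

theorem tensorCopies_eq_extendCopies [Fintype κ] (h : i ≠ j) (B : κ → CopyOp ι) :
    tensorCopies B = extendCopies h B (kroneckerCopies (B i) (B j)) := by
  ext s t
  exact prod_eq_mul_mul_prod_otherSites h _

variable {i j : Fin n}

theorem onPair_eq_submatrix (h : i ≠ j) (A : PairOp q) :
    onPair i j A = (A ⊗ₖ (1 : Matrix (OtherSites i j → Fin q) (OtherSites i j → Fin q) ℂ)).submatrix
      (splitPair h) (splitPair h) := by
  ext s t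
  simp only [onPair, Matrix.of_apply, Matrix.submatrix_apply, splitPair, Equiv.coe_fn_mk,
    Matrix.kroneckerMap_apply, Matrix.one_apply, funext_iff, Subtype.forall, and_imp, mul_ite,
    mul_one, mul_zero]

/-- The embedding of the operators on two qudits into those on `n` qudits as a homomorphism. -/
def onPairHom (h : i ≠ j) : PairOp q →* Op n q where
  toFun := onPair i j
  map_one' := by
    rw [onPair_eq_submatrix h, Matrix.one_kronecker_one, Matrix.submatrix_one_equiv]
  map_mul' A B := by
    simp only [onPair_eq_submatrix h, Matrix.submatrix_mul_equiv, ← Matrix.mul_kronecker_mul,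
      one_mul]

theorem onPairHom_apply (h : i ≠ j) (A : PairOp q) : onPairHom h A = onPair i j A :=
  rfl

theorem conjTranspose_onPair (h : i ≠ j) (A : PairOp q) : (onPair i j A)ᴴ = onPair i j Aᴴ := by
  rw [onPair_eq_submatrix h, onPair_eq_submatrix h, Matrix.conjTranspose_submatrix,
    Matrix.conjTranspose_kronecker, Matrix.conjTranspose_one]

theorem onPair_mem_unitaryGroup (h : i ≠ j) {A : PairOp q}
    (hA : A ∈ Matrix.unitaryGroup (Fin q × Fin q) ℂ) :
    onPair i j A ∈ Matrix.unitaryGroup (Fin n → Fin q) ℂ := by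
  rw [Matrix.mem_unitaryGroup_iff, Matrix.star_eq_conjTranspose] at hA ⊢
  rw [conjTranspose_onPair h, ← onPairHom_apply h, ← onPairHom_apply h, ← map_mul, hA, map_one]

theorem continuous_onPair (i j : Fin n) : Continuous (onPair i j : PairOp q → Op n q) := by
  refine continuous_matrix fun s t => ?_
  simp only [onPair, Matrix.of_apply]
  split_ifs
  · exact continuous_id.matrix_elem _ _
  · exact continuous_const

theorem conjCopies_onPair_tensorCopies (h : i ≠ j) (A : PairOp q) (B : Fin n → CopyOp (Fin q)) :
    conjCopies (onPair i j A) (tensorCopies B) =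
      extendCopies h B (conjCopies A (kroneckerCopies (B i) (B j))) := by
  rw [tensorCopies_eq_extendCopies h, onPair_eq_submatrix h, extendCopies_apply,
    conjCopies_submatrix, conjCopies_kroneckerCopies, conjCopies_one_apply, extendCopies_apply]

theorem tensorCopies_setPair_one (h : i ≠ j) (B : Fin n → CopyOp (Fin q)) :
    tensorCopies (setPair i j B 1) = extendCopies h B 1 := by
  rw [tensorCopies_eq_extendCopies h, extendCopies_setPair, setPair_left, setPair_right,
    kroneckerCopies_one]

theorem tensorCopies_setPair_swapMatrix (h : i ≠ j) (B : Fin n → CopyOp (Fin q)) :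
    tensorCopies (setPair i j B (swapMatrix ℂ (Fin q))) =
      extendCopies h B (swapMatrix ℂ (Fin q × Fin q)) := by
  rw [tensorCopies_eq_extendCopies h, extendCopies_setPair, setPair_left, setPair_right,
    kroneckerCopies_swapMatrix]

theorem IsTwoDesign.exists_integral_conjCopies_onPair [NeZero q]
    {μ : Measure (Matrix.unitaryGroup (Fin q × Fin q) ℂ)} [IsProbabilityMeasure μ]
    (hμ : IsTwoDesign μ) {P Q : PairOp q} (hP : P ∈ Matrix.unitaryGroup (Fin q × Fin q) ℂ)
    (hQ : Q ∈ Matrix.unitaryGroup (Fin q × Fin q) ℂ) (h : i ≠ j) (B : Fin n → CopyOp (Fin q)) :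
    ∃ α β : ℂ,
      (∀ l, labelWeight l (B i) * labelWeight l (B j) =
        α + β * labelWeight l (swapMatrix ℂ (Fin q)) ^ 2) ∧
      ∀ L : CopyOp (Fin n → Fin q) →ₗ[ℂ] ℂ,
        ∫ V, L (conjCopies (onPair i j (P * V.1 * Q)) (tensorCopies B)) ∂μ =
          α * L (tensorCopies (setPair i j B 1)) +
            β * L (tensorCopies (setPair i j B (swapMatrix ℂ (Fin q)))) := by
  obtain ⟨α, β, htwirl⟩ := hμ.exists_twirl_eq (conjCopies P (kroneckerCopies (B i) (B j)))
  refine ⟨α, β, fun l => ?_, fun L => ?_⟩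
  · rw [← labelWeight_kroneckerCopies, ← labelWeight_conjCopies hP, ← labelWeight_twirl μ, htwirl,
      map_add, map_smul, map_smul, labelWeight_one, ← kroneckerCopies_swapMatrix,
      labelWeight_kroneckerCopies, smul_eq_mul, smul_eq_mul, mul_one, sq]
  · simp only [conjCopies_onPair_tensorCopies h, conjCopies_mul, tensorCopies_setPair_one h,
      tensorCopies_setPair_swapMatrix h]
    have hL := linearMap_twirl μ (L ∘ₗ extendCopies h B ∘ₗ conjCopies Q)
      (conjCopies P (kroneckerCopies (B i) (B j)))
    rw [htwirl] at hL
    simpa only [map_add, map_smul, LinearMap.comp_apply, conjCopies_one hQ,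
      conjCopies_swapMatrix hQ, smul_eq_mul] using hL.symm

end Pair

/-! ### Expectations in the biased random walk -/

section Expectation

variable {α β E : Type*} [Fintype α] [Fintype β] [AddCommGroup E] [Module ℝ E]

/-- The expectation of a vector-valued function on a finite type. -/
noncomputable def expect (P : PMF α) (f : α → E) : E :=
  ∑ a, (P a).toReal • f a

theorem expect_pure (a : α) (f : α → E) : expect (PMF.pure a) f = f a := by
  rw [expect, Fintype.sum_eq_single a]
  · rw [PMF.pure_apply, if_pos rfl, ENNReal.toReal_one, one_smul]
  · intro b hb
    rw [PMF.pure_apply, if_neg hb, ENNReal.toReal_zero, zero_smul]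

theorem expect_bind (P : PMF α) (g : α → PMF β) (f : β → E) :
    expect (P.bind g) f = expect P fun a => expect (g a) f := by
  have toReal_bind_apply (b : β) : (P.bind g b).toReal = ∑ a, (P a).toReal * (g a b).toReal := by
    rw [PMF.bind_apply, tsum_fintype, ENNReal.toReal_sum fun a _ =>
      ENNReal.mul_ne_top (P.apply_ne_top a) ((g a).apply_ne_top b)]
    simp only [ENNReal.toReal_mul]
  simp only [expect, toReal_bind_apply, Finset.sum_smul, Finset.smul_sum, mul_smul]
  exact Finset.sum_comm

theorem expect_map (P : PMF α) (g : α → β) (f : β → E) :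
    expect (P.map g) f = expect P fun a => f (g a) := by
  rw [PMF.map, expect_bind]
  simp only [Function.comp_apply, expect_pure]

theorem expect_const (P : PMF α) (x : E) : expect P (fun _ => x) = x := by
  rw [expect, ← Finset.sum_smul, ← ENNReal.toReal_sum fun a _ => P.apply_ne_top a,
    ← tsum_fintype (L := .unconditional _), P.tsum_coe, ENNReal.toReal_one, one_smul]

theorem expect_add (P : PMF α) (f g : α → E) :
    expect P (fun a => f a + g a) = expect P f + expect P g := by
  simp only [expect, smul_add, Finset.sum_add_distrib]

theorem expect_const_mul {R : Type*} [Ring R] [Algebra ℝ R] (P : PMF α) (x : R) (f : α → R) :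
    expect P (fun a => x * f a) = x * expect P f := by
  simp only [expect, mul_smul_comm, Finset.mul_sum]

theorem expect_indicator (P : PMF α) (s : Set α) (x : E) :
    expect P (s.indicator fun _ => x) = (P.toOuterMeasure s).toReal • x := by
  classical
  rw [PMF.toOuterMeasure_apply_fintype, ENNReal.toReal_sum, Finset.sum_smul, expect]
  · refine Finset.sum_congr rfl fun a _ => ?_
    by_cases h : a ∈ s <;> simp [h]
  · intro a _
    by_cases h : a ∈ s <;> simp [h, P.apply_ne_top]

end Expectation

section Walk

variable {n q : ℕ} {i j : Fin n}

theorem expect_labelLaw (d : ℕ) (f : Label → ℂ) :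
    expect (labelLaw d) f = (f .S + d * f .I) / (d + 1) := by
  have huniv : (Finset.univ : Finset Label) = {Label.I, Label.S} := rfl
  have htoReal : ((d : ℝ≥0∞) + 1).toReal = (d : ℝ) + 1 := by
    rw [ENNReal.toReal_add (by simp) (by simp), ENNReal.toReal_natCast, ENNReal.toReal_one]
  rw [expect, huniv, Finset.sum_pair (by decide)]
  simp only [labelLaw, PMF.ofFintype_apply, ENNReal.toReal_div, htoReal, ENNReal.toReal_natCast,
    ENNReal.toReal_one, Complex.real_smul]
  push_cast
  ring

theorem expect_initialLaw_prod (v : Fin n → Label → ℂ) :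
    expect (initialLaw n q) (fun c => ∏ k, v k (c k)) = ∏ k, expect (labelLaw q) (v k) := by
  simp only [expect, Finset.prod_univ_sum, Fintype.piFinset_univ, initialLaw,
    PMF.ofFintype_apply, ENNReal.toReal_prod, Complex.real_smul, Complex.ofReal_prod,
    Finset.prod_mul_distrib]

theorem expect_gateStep_prod (h : i ≠ j) (v : Fin n → Label → ℂ) (c : Fin n → Label) :
    expect (gateStep q (i, j) c) (fun c' => ∏ k, v k (c' k)) =
      (if c i = c j then v i (c i) * v j (c j)
        else (v i .S * v j .S + (q : ℂ) ^ 2 * (v i .I * v j .I)) / ((q : ℂ) ^ 2 + 1)) *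
        ∏ k : OtherSites i j, v k (c k) := by
  split_ifs with hc
  · rw [gateStep, if_pos hc, expect_pure, prod_eq_mul_mul_prod_otherSites h]
  · rw [gateStep, if_neg hc, expect_map]
    change expect (labelLaw (q ^ 2)) (fun l => ∏ k, v k (setPair i j c l k)) = _
    simp only [prod_eq_mul_mul_prod_otherSites h, setPair_left, setPair_right, setPair_otherSites]
    rw [expect_labelLaw]
    push_cast
    ring

theorem expect_biasedWalk_zero {E : Type*} [AddCommGroup E] [Module ℝ E]
    (e : Fin 0 → Fin n × Fin n) (f : (Fin n → Label) → E) :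
    expect (biasedWalk n q 0 e) (fun γ => f (γ (Fin.last 0))) = expect (initialLaw n q) f := by
  rw [biasedWalk, expect_map]

theorem expect_biasedWalk_succ {E : Type*} [AddCommGroup E] [Module ℝ E] {m : ℕ}
    (e : Fin (m + 1) → Fin n × Fin n) (f : (Fin n → Label) → E) :
    expect (biasedWalk n q (m + 1) e) (fun γ => f (γ (Fin.last (m + 1)))) =
      expect (biasedWalk n q m fun t => e t.castSucc) fun γ =>
        expect (gateStep q (e (Fin.last m)) (γ (Fin.last m))) f := by
  rw [biasedWalk, expect_bind]
  simp only [expect_map, Fin.snoc_last]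

theorem apply_eq_expect_labelWeight {ι : Type*} [Fintype ι] [DecidableEq ι] {B : CopyOp ι}
    (hB : B = 1 ∨ B = swapMatrix ℂ ι) (a : ι) :
    B (a, a) (a, a) = expect (labelLaw (Fintype.card ι)) fun l => labelWeight l B := by
  have : Nonempty ι := ⟨a⟩
  rcases hB with rfl | rfl
  · simp only [labelWeight_one, expect_const, Matrix.one_apply_eq]
  · have hd : (Fintype.card ι : ℂ) ≠ 0 := by simp
    rw [expect_labelLaw, labelWeight_S_swapMatrix, labelWeight_I_swapMatrix, mul_inv_cancel₀ hd,
      div_self (Nat.cast_add_one_ne_zero _), swapMatrix_apply,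
      Prod.swap_prod_mk, if_pos rfl]

theorem expect_gateStep_prod_labelWeight [NeZero q] (h : i ≠ j) (B : Fin n → CopyOp (Fin q))
    {α β : ℂ}
    (hαβ : ∀ l, labelWeight l (B i) * labelWeight l (B j) =
      α + β * labelWeight l (swapMatrix ℂ (Fin q)) ^ 2) (c : Fin n → Label) :
    expect (gateStep q (i, j) c) (fun c' => ∏ k, labelWeight (c' k) (B k)) =
      α * ∏ k, labelWeight (c k) (setPair i j B 1 k) +
        β * ∏ k, labelWeight (c k) (setPair i j B (swapMatrix ℂ (Fin q)) k) := by
  have hq : (q : ℂ) ≠ 0 := NeZero.ne _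
  have hq2 : (q : ℂ) ^ 2 + 1 ≠ 0 := by exact_mod_cast Nat.succ_ne_zero (q ^ 2)
  have hI := labelWeight_I_swapMatrix (ι := Fin q)
  have hS := labelWeight_S_swapMatrix (ι := Fin q)
  rw [Fintype.card_fin] at hI hS
  have hpair : (if c i = c j then labelWeight (c i) (B i) * labelWeight (c j) (B j)
      else (labelWeight .S (B i) * labelWeight .S (B j) +
        (q : ℂ) ^ 2 * (labelWeight .I (B i) * labelWeight .I (B j))) / ((q : ℂ) ^ 2 + 1)) =
      α + β * (labelWeight (c i) (swapMatrix ℂ (Fin q)) *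
        labelWeight (c j) (swapMatrix ℂ (Fin q))) := by
    split_ifs with hc
    · rw [hc, hαβ, sq]
    · have hIS : labelWeight (c i) (swapMatrix ℂ (Fin q)) *
          labelWeight (c j) (swapMatrix ℂ (Fin q)) = 1 := by
        cases hi : c i <;> cases hj : c j <;> simp_all
      rw [hIS, hαβ, hαβ, hI, hS]
      field_simp
      ring
  rw [expect_gateStep_prod h (fun k l => labelWeight l (B k)), hpair,
    prod_setPair h fun _ D l => labelWeight l D, prod_setPair h fun _ D l => labelWeight l D,
    labelWeight_one, labelWeight_one]
  ring

end Walk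

/-! ### Unitarity and continuity of the circuit -/

section Circuit

theorem exp_neg_I_smul_mem_unitaryGroup {ι : Type*} [Fintype ι] [DecidableEq ι]
    {A : Matrix ι ι ℂ} (hA : A.IsHermitian) (θ : ℝ) :
    NormedSpace.exp ((-(Complex.I * (θ : ℂ))) • A) ∈ Matrix.unitaryGroup ι ℂ := by
  set X := (-(Complex.I * (θ : ℂ))) • A with hX
  have hskew : Xᴴ = -X := by
    rw [hX, Matrix.conjTranspose_smul, hA.eq, ← neg_smul]
    simp
  rw [Matrix.mem_unitaryGroup_iff, Matrix.star_eq_conjTranspose, ← Matrix.exp_conjTranspose, hskew,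
    ← Matrix.exp_add_of_commute _ _ (Commute.refl X).neg_right, add_neg_cancel,
    NormedSpace.exp_zero]

theorem timeOrdered_mem {M S : Type*} [Monoid M] [SetLike S M] [SubmonoidClass S M] {s : S}
    {l : List M} (h : ∀ a ∈ l, a ∈ s) : timeOrdered l ∈ s :=
  list_prod_mem fun a ha => h a (List.mem_reverse.mp ha)

theorem timeOrdered_map {M N F : Type*} [Monoid M] [Monoid N] [FunLike F M N]
    [MonoidHomClass F M N] (f : F) (l : List M) :
    timeOrdered (l.map f) = f (timeOrdered l) := by
  rw [timeOrdered, timeOrdered, map_list_prod, List.map_reverse]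

theorem timeOrdered_ofFn_succ {M : Type*} [Monoid M] {m : ℕ} (f : Fin (m + 1) → M) :
    timeOrdered (List.ofFn f) =
      f (Fin.last m) * timeOrdered (List.ofFn fun t : Fin m => f t.castSucc) := by
  rw [List.ofFn_succ', timeOrdered, List.concat_eq_append, List.reverse_append,
    List.reverse_singleton, List.singleton_append, List.prod_cons, timeOrdered]

theorem continuous_timeOrdered {X ι M : Type*} [TopologicalSpace X] [TopologicalSpace M] [Monoid M]
    [ContinuousMul M] {f : ι → X → M} (hf : ∀ i, Continuous (f i)) (l : List ι) :
    Continuous fun x => timeOrdered (l.map fun i => f i x) := by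
  simp only [timeOrdered, ← List.map_reverse]
  exact continuous_list_prod _ fun i _ => hf i

variable {n q p m : ℕ}

theorem ParamGate.toOp_mem_unitaryGroup (G : ParamGate q p) (θ : Fin p → ℝ) :
    G.toOp θ ∈ Matrix.unitaryGroup (Fin q × Fin q) ℂ :=
  mul_mem (mul_mem G.Wl.2 (exp_neg_I_smul_mem_unitaryGroup G.hermitian _)) G.Wr.2

theorem ParamGate.continuous_toOp (G : ParamGate q p) : Continuous G.toOp := by
  have hexp : Continuous fun X : PairOp q => NormedSpace.exp X := by
    open scoped Matrix.Norms.Operator in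
    exact NormedSpace.exp_continuous
  unfold ParamGate.toOp
  exact (continuous_const.mul (hexp.comp (by fun_prop))).mul continuous_const

/-- The product of a list of parameterized gates as an operator on two qudits. -/
noncomputable def gatesOp (l : List (ParamGate q p)) (θ : Fin p → ℝ) : PairOp q :=
  timeOrdered (l.map fun G => G.toOp θ)

theorem gatesOp_mem_unitaryGroup (l : List (ParamGate q p)) (θ : Fin p → ℝ) :
    gatesOp l θ ∈ Matrix.unitaryGroup (Fin q × Fin q) ℂ := by
  refine timeOrdered_mem fun a ha => ?_
  obtain ⟨G, -, rfl⟩ := List.mem_map.mp ha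
  exact G.toOp_mem_unitaryGroup θ

theorem continuous_gatesOp (l : List (ParamGate q p)) : Continuous (gatesOp l) :=
  continuous_timeOrdered ParamGate.continuous_toOp l

theorem Block.toOp_eq_onPair (b : Block n q p) (V : Matrix.unitaryGroup (Fin q × Fin q) ℂ)
    (θ : Fin p → ℝ) :
    b.toOp V θ = onPair b.i b.j (gatesOp b.post θ * V.1 * gatesOp b.pre θ) := by
  have hgates (l : List (ParamGate q p)) :
      timeOrdered (l.map fun G => onPair b.i b.j (G.toOp θ)) = onPairHom b.ne (gatesOp l θ) := by
    rw [gatesOp, ← timeOrdered_map, List.map_map]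
    rfl
  rw [Block.toOp, hgates, hgates, ← onPairHom_apply b.ne, ← onPairHom_apply b.ne, map_mul, map_mul]

theorem Block.toOp_mem_unitaryGroup (b : Block n q p)
    (V : Matrix.unitaryGroup (Fin q × Fin q) ℂ) (θ : Fin p → ℝ) :
    b.toOp V θ ∈ Matrix.unitaryGroup (Fin n → Fin q) ℂ := by
  rw [b.toOp_eq_onPair]
  exact onPair_mem_unitaryGroup b.ne
    (mul_mem (mul_mem (gatesOp_mem_unitaryGroup _ _) V.2) (gatesOp_mem_unitaryGroup _ _))

theorem Block.continuous_toOp (b : Block n q p) : Continuous fun z :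
    Matrix.unitaryGroup (Fin q × Fin q) ℂ × (Fin p → ℝ) => b.toOp z.1 z.2 := by
  simp only [b.toOp_eq_onPair]
  exact (continuous_onPair _ _).comp
    ((((continuous_gatesOp _).comp continuous_snd).mul
      (continuous_subtype_val.comp continuous_fst)).mul
        ((continuous_gatesOp _).comp continuous_snd))

/-- The operator of a sequence of blocks, which, unlike a `Circuit`, need not cover all sites and
so can be shortened. -/
noncomputable def blocksOp (b : Fin m → Block n q p)
    (V : Fin m → Matrix.unitaryGroup (Fin q × Fin q) ℂ) (θ : Fin p → ℝ) : Op n q :=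
  timeOrdered (List.ofFn fun t => (b t).toOp (V t) θ)

theorem blocksOp_zero (b : Fin 0 → Block n q p)
    (V : Fin 0 → Matrix.unitaryGroup (Fin q × Fin q) ℂ) (θ : Fin p → ℝ) : blocksOp b V θ = 1 := by
  rw [blocksOp, List.ofFn_zero, timeOrdered, List.reverse_nil, List.prod_nil]

theorem blocksOp_snoc (b : Fin (m + 1) → Block n q p)
    (V : Fin m → Matrix.unitaryGroup (Fin q × Fin q) ℂ)
    (W : Matrix.unitaryGroup (Fin q × Fin q) ℂ) (θ : Fin p → ℝ) :
    blocksOp b (Fin.snoc (α := fun _ => Matrix.unitaryGroup (Fin q × Fin q) ℂ) V W) θ =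
      (b (Fin.last m)).toOp W θ * blocksOp (fun t => b t.castSucc) V θ := by
  simp only [blocksOp, timeOrdered_ofFn_succ, Fin.snoc_last, Fin.snoc_castSucc]

theorem blocksOp_mem_unitaryGroup (b : Fin m → Block n q p)
    (V : Fin m → Matrix.unitaryGroup (Fin q × Fin q) ℂ) (θ : Fin p → ℝ) :
    blocksOp b V θ ∈ Matrix.unitaryGroup (Fin n → Fin q) ℂ := by
  refine timeOrdered_mem fun a ha => ?_
  obtain ⟨t, rfl⟩ := (List.mem_ofFn' _ _).mp ha
  exact (b t).toOp_mem_unitaryGroup _ _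

theorem continuous_blocksOp (b : Fin m → Block n q p) : Continuous fun z :
    (Fin m → Matrix.unitaryGroup (Fin q × Fin q) ℂ) × (Fin p → ℝ) => blocksOp b z.1 z.2 := by
  simp only [blocksOp, List.ofFn_eq_map]
  exact continuous_timeOrdered (fun t => (b t).continuous_toOp.comp
    (((continuous_apply t).comp continuous_fst).prodMk continuous_snd)) _

end Circuit

/-! ### The average over the entangling gates -/

section Walk

theorem integral_pi_snoc {m : ℕ} {X E : Type*} [MeasurableSpace X] [NormedAddCommGroup E]
    [NormedSpace ℝ E] (μ : Fin (m + 1) → Measure X) [∀ t, SigmaFinite (μ t)]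
    {f : (Fin (m + 1) → X) → E} (hf : Integrable f (Measure.pi μ)) :
    ∫ V, f V ∂(Measure.pi μ) = ∫ V, ∫ x, f (Fin.snoc (α := fun _ => X) V x) ∂(μ (Fin.last m))
      ∂(Measure.pi fun t => μ t.castSucc) := by
  have hmp := (measurePreserving_piFinSuccAbove μ (Fin.last m)).symm
  rw [← hmp.integral_comp']
  refine (integral_prod_symm _ (hmp.integrable_comp_of_integrable hf)).trans ?_
  simp only [Fin.succAbove_last]
  congr! 4 with V x
  exact congrArg f (Fin.insertNth_last' x V)

theorem forall_exists_or_setPair {κ α : Type*} [DecidableEq κ] {m : ℕ}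
    (e : Fin (m + 1) → κ × κ) {P : α → Prop} {B : κ → α}
    (hB : ∀ k, (∃ t, k = (e t).1 ∨ k = (e t).2) ∨ P (B k)) {D : α} (hD : P D) (k : κ) :
    (∃ t : Fin m, k = (e t.castSucc).1 ∨ k = (e t.castSucc).2) ∨
      P (setPair (e (Fin.last m)).1 (e (Fin.last m)).2 B D k) := by
  by_cases hk : k ≠ (e (Fin.last m)).1 ∧ k ≠ (e (Fin.last m)).2
  · rw [setPair_otherSites B D ⟨k, hk⟩]
    refine (hB k).imp_left ?_
    rintro ⟨t, ht⟩
    induction t using Fin.lastCases with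
    | last => exact absurd ht (not_or.mpr hk)
    | cast t => exact ⟨t, ht⟩
  · right
    obtain rfl | rfl : k = (e (Fin.last m)).1 ∨ k = (e (Fin.last m)).2 := by tauto
    · rwa [setPair_left]
    · rwa [setPair_right]

variable {n q p m : ℕ}

theorem tensorCopies_apply_eq_expect {B : Fin n → CopyOp (Fin q)}
    (hB : ∀ k, B k = 1 ∨ B k = swapMatrix ℂ (Fin q)) (s : Fin n → Fin q) :
    tensorCopies B (s, s) (s, s) =
      expect (initialLaw n q) fun c => ∏ k, labelWeight (c k) (B k) := by
  rw [expect_initialLaw_prod fun k l => labelWeight l (B k), tensorCopies_apply]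
  refine Finset.prod_congr rfl fun k _ => ?_
  rw [apply_eq_expect_labelWeight (hB k), Fintype.card_fin]

theorem integrable_conjCopies_blocksOp (b : Fin m → Block n q p)
    (μ : Fin m → Measure (Matrix.unitaryGroup (Fin q × Fin q) ℂ)) [∀ t, IsFiniteMeasure (μ t)]
    (θ : Fin p → ℝ) (Y : CopyOp (Fin n → Fin q)) (s t : (Fin n → Fin q) × (Fin n → Fin q)) :
    Integrable (fun V => conjCopies (blocksOp b V θ) Y s t) (Measure.pi μ) :=
  integrable_of_continuous _ <| ((continuous_conjCopies Y).comp
    ((continuous_blocksOp b).comp (continuous_id.prodMk continuous_const))).matrix_elem s t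

/-- The mean over the entangling gates of `⟨s s| (U ⊗ U)† Y (U ⊗ U) |s s⟩`, where `U` is the
operator of the blocks and `Y` is the product of the operators `B k`. -/
noncomputable def secondMoment (b : Fin m → Block n q p)
    (μ : Fin m → Measure (Matrix.unitaryGroup (Fin q × Fin q) ℂ)) (θ : Fin p → ℝ)
    (s : Fin n → Fin q) (B : Fin n → CopyOp (Fin q)) : ℂ :=
  ∫ V, conjCopies (blocksOp b V θ) (tensorCopies B) (s, s) (s, s) ∂(Measure.pi μ)

variable [NeZero q]

theorem exists_secondMoment_succ_eq (b : Fin (m + 1) → Block n q p)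
    (μ : Fin (m + 1) → Measure (Matrix.unitaryGroup (Fin q × Fin q) ℂ))
    [∀ t, IsProbabilityMeasure (μ t)] (hμ : IsTwoDesign (μ (Fin.last m)))
    (θ : Fin p → ℝ) (s : Fin n → Fin q) (B : Fin n → CopyOp (Fin q)) :
    ∃ α β : ℂ,
      (∀ l, labelWeight l (B (b (Fin.last m)).i) * labelWeight l (B (b (Fin.last m)).j) =
        α + β * labelWeight l (swapMatrix ℂ (Fin q)) ^ 2) ∧
      secondMoment b μ θ s B =
        α * secondMoment (fun t => b t.castSucc) (fun t => μ t.castSucc) θ s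
            (setPair (b (Fin.last m)).i (b (Fin.last m)).j B 1) +
          β * secondMoment (fun t => b t.castSucc) (fun t => μ t.castSucc) θ s
            (setPair (b (Fin.last m)).i (b (Fin.last m)).j B (swapMatrix ℂ (Fin q))) := by
  obtain ⟨α, β, hαβ, hgate⟩ := hμ.exists_integral_conjCopies_onPair
    (gatesOp_mem_unitaryGroup (b (Fin.last m)).post θ)
    (gatesOp_mem_unitaryGroup (b (Fin.last m)).pre θ) (b (Fin.last m)).ne B
  refine ⟨α, β, hαβ, ?_⟩
  simp only [secondMoment]
  rw [integral_pi_snoc μ (integrable_conjCopies_blocksOp b μ θ _ _ _), ← integral_const_mul,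
    ← integral_const_mul, ← integral_add]
  · refine integral_congr_ae (Filter.Eventually.of_forall fun V => ?_)
    simp only [blocksOp_snoc, Block.toOp_eq_onPair, conjCopies_mul]
    exact hgate (Matrix.entryLinearMap ℂ ℂ (s, s) (s, s) ∘ₗ
      conjCopies (blocksOp (fun t => b t.castSucc) V θ))
  all_goals exact (integrable_conjCopies_blocksOp _ _ θ _ _ _).const_mul _

/- A site on which no gate acts enters through the entry of `B k` at `s k`, which is the mean of the
label weights only if `B k` is `1` or the swap. Since a gate leaves just these two behind, the
hypothesis on `B` is preserved by the induction. -/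
theorem secondMoment_eq_expect (b : Fin m → Block n q p)
    (μ : Fin m → Measure (Matrix.unitaryGroup (Fin q × Fin q) ℂ)) [∀ t, IsProbabilityMeasure (μ t)]
    (hμ : ∀ t, IsTwoDesign (μ t)) (θ : Fin p → ℝ) (s : Fin n → Fin q) (B : Fin n → CopyOp (Fin q))
    (hB : ∀ k, (∃ t, k = (b t).i ∨ k = (b t).j) ∨ B k = 1 ∨ B k = swapMatrix ℂ (Fin q)) :
    secondMoment b μ θ s B = expect (biasedWalk n q m fun t => ((b t).i, (b t).j)) fun γ =>
      ∏ k, labelWeight (γ (Fin.last m) k) (B k) := by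
  induction m generalizing B with
  | zero =>
    rw [expect_biasedWalk_zero _ fun c => ∏ k, labelWeight (c k) (B k)]
    simp only [secondMoment, blocksOp_zero, conjCopies_one_apply, integral_const, probReal_univ,
      one_smul]
    exact tensorCopies_apply_eq_expect (fun k => (hB k).resolve_left fun ⟨t, _⟩ => t.elim0) s
  | succ m ih =>
    obtain ⟨α, β, hαβ, hsucc⟩ := exists_secondMoment_succ_eq b μ (hμ _) θ s B
    have hrec {D : CopyOp (Fin q)} (hD : D = 1 ∨ D = swapMatrix ℂ (Fin q)) :=
      ih (fun t => b t.castSucc) (fun t => μ t.castSucc) (fun t => hμ _)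
        (setPair (b (Fin.last m)).i (b (Fin.last m)).j B D)
        (forall_exists_or_setPair (fun t => ((b t).i, (b t).j))
          (P := fun Y => Y = 1 ∨ Y = swapMatrix ℂ (Fin q)) hB hD)
    rw [hsucc, hrec (.inl rfl), hrec (.inr rfl),
      expect_biasedWalk_succ _ fun c => ∏ k, labelWeight (c k) (B k)]
    simp only [expect_gateStep_prod_labelWeight (b (Fin.last m)).ne B hαβ, expect_add,
      expect_const_mul]

end Walk

/-! ### The second moment of the expectation value -/

section SecondMoment

theorem labelWeight_kronecker_conjTranspose {ι : Type*} [Fintype ι] [DecidableEq ι] [Nonempty ι]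
    {A : Matrix ι ι ℂ} (h0 : A.trace = 0) (hA : (Aᴴ * A).trace = Fintype.card ι) (l : Label) :
    labelWeight l (A ⊗ₖ Aᴴ) = if l = .S then 1 else 0 := by
  cases l
  · simp [labelWeight_I, Matrix.trace_kronecker, h0]
  · rw [labelWeight_S, trace_swapMatrix_mul_kronecker, Matrix.trace_mul_comm, hA, if_pos rfl]
    exact inv_mul_cancel₀ (by simp)

instance (p : ℕ) : IsProbabilityMeasure (uniformParams p) := by
  have hvol : volume (Set.Icc (0 : Fin p → ℝ) fun _ => 2 * Real.pi) =
      ∏ _ : Fin p, ENNReal.ofReal (2 * Real.pi) := by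
    rw [Real.volume_Icc_pi]
    simp
  refine ProbabilityTheory.cond_isProbabilityMeasure_of_finite ?_ ?_
  · rw [hvol]
    exact Finset.prod_ne_zero_iff.mpr fun _ _ => (ENNReal.ofReal_pos.mpr Real.two_pi_pos).ne'
  · rw [hvol]
    exact ENNReal.prod_ne_top fun _ _ => ENNReal.ofReal_ne_top

variable {n q p m : ℕ} [NeZero q]

theorem prod_labelWeight_kronecker_conjTranspose {M : Fin n → Matrix (Fin q) (Fin q) ℂ}
    {T : Set (Fin n)} (h1 : ∀ k ∉ T, M k = 1) (h0 : ∀ k ∈ T, (M k).trace = 0)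
    (hM : ∀ k ∈ T, ((M k)ᴴ * M k).trace = q) (c : Fin n → Label) :
    ∏ k, labelWeight (c k) (M k ⊗ₖ (M k)ᴴ) = {c | T ⊆ sSites c}.indicator (fun _ => 1) c := by
  classical
  have hweight (k : Fin n) :
      labelWeight (c k) (M k ⊗ₖ (M k)ᴴ) = if k ∈ T → k ∈ sSites c then 1 else 0 := by
    by_cases hk : k ∈ T
    · rw [labelWeight_kronecker_conjTranspose (h0 k hk) (by rw [hM k hk, Fintype.card_fin])]
      exact if_congr (imp_iff_right hk).symm rfl rfl
    · rw [h1 k hk, Matrix.conjTranspose_one, Matrix.one_kronecker_one, labelWeight_one,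
        if_pos fun h => absurd h hk]
  simp only [hweight, Finset.prod_ite_zero, Finset.prod_const_one, Finset.mem_univ, true_imp_iff,
    Set.indicator_apply]
  exact if_congr Iff.rfl rfl rfl

theorem Circuit.star_expval (C : Circuit n q p m) (X : Op n q)
    (V : Fin m → Matrix.unitaryGroup (Fin q × Fin q) ℂ) (θ : Fin p → ℝ) :
    star (C.expval X V θ) = C.expval Xᴴ V θ := by
  rw [Circuit.expval, Circuit.expval, zeroExpectation, zeroExpectation,
    ← Matrix.conjTranspose_apply, Matrix.conjTranspose_mul, Matrix.conjTranspose_mul,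
    Matrix.conjTranspose_conjTranspose, mul_assoc]

theorem Circuit.ofReal_norm_expval_sq (C : Circuit n q p m) (X : Op n q)
    (V : Fin m → Matrix.unitaryGroup (Fin q × Fin q) ℂ) (θ : Fin p → ℝ) :
    ((‖C.expval X V θ‖ ^ 2 : ℝ) : ℂ) =
      conjCopies (blocksOp C.block V θ) (X ⊗ₖ Xᴴ) (fun _ => 0, fun _ => 0)
        (fun _ => 0, fun _ => 0) := by
  rw [conjCopies_kronecker, Matrix.kroneckerMap_apply]
  change _ = C.expval X V θ * C.expval Xᴴ V θ
  rw [← C.star_expval, Complex.star_def, Complex.mul_conj, Complex.normSq_eq_norm_sq]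

theorem Circuit.expval_sq_of_isHermitian (C : Circuit n q p m) {X : Op n q} (hX : X.IsHermitian)
    (V : Fin m → Matrix.unitaryGroup (Fin q × Fin q) ℂ) (θ : Fin p → ℝ) :
    C.expval X V θ ^ 2 = ((‖C.expval X V θ‖ ^ 2 : ℝ) : ℂ) := by
  have hreal := C.star_expval X V θ
  rw [hX.eq, Complex.star_def] at hreal
  rw [← Complex.normSq_eq_norm_sq, ← Complex.mul_conj, hreal, sq]

theorem Circuit.integrable_norm_expval_sq (C : Circuit n q p m) (X : Op n q)
    (μ : Measure (Fin m → Matrix.unitaryGroup (Fin q × Fin q) ℂ)) [IsFiniteMeasure μ]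
    (ν : Measure (Fin p → ℝ)) [IsFiniteMeasure ν] :
    Integrable (Function.uncurry fun V θ => ‖C.expval X V θ‖ ^ 2) (μ.prod ν) := by
  have hcont : Continuous fun U : Op n q => zeroExpectation (Uᴴ * X * U) :=
    ((continuous_id.matrix_conjTranspose.matrix_mul continuous_const).matrix_mul
      continuous_id).matrix_elem _ _
  obtain ⟨K, hK⟩ := isCompact_univ.exists_bound_of_continuousOn
    (hcont.comp (continuous_subtype_val (p := (· ∈ Matrix.unitaryGroup (Fin n → Fin q) ℂ))
      )).continuousOn
  refine Integrable.of_bound ((hcont.comp (continuous_blocksOp C.block)).norm.pow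
    2).aestronglyMeasurable (K ^ 2) (Filter.Eventually.of_forall fun z => ?_)
  rw [Function.uncurry_def, norm_pow, norm_norm]
  exact pow_le_pow_left₀ (norm_nonneg _)
    (hK ⟨_, blocksOp_mem_unitaryGroup C.block z.1 z.2⟩ (Set.mem_univ _)) 2

theorem Circuit.integral_norm_expval_sq (C : Circuit n q p m)
    (μ : Fin m → Measure (Matrix.unitaryGroup (Fin q × Fin q) ℂ)) [∀ t, IsProbabilityMeasure (μ t)]
    (hμ : ∀ t, IsTwoDesign (μ t)) {M : Fin n → Matrix (Fin q) (Fin q) ℂ} {T : Set (Fin n)}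
    (h1 : ∀ k ∉ T, M k = 1) (h0 : ∀ k ∈ T, (M k).trace = 0)
    (hM : ∀ k ∈ T, ((M k)ᴴ * M k).trace = q) (θ : Fin p → ℝ) :
    ∫ V, ‖C.expval (tensor M) V θ‖ ^ 2 ∂(Measure.pi μ) =
      ((biasedWalk n q m C.pairs).toOuterMeasure {γ | T ⊆ sSites (γ (Fin.last m))}).toReal := by
  rw [← Complex.ofReal_inj, ← integral_complex_ofReal]
  simp only [C.ofReal_norm_expval_sq, conjTranspose_tensor, tensor_kronecker_tensor]
  refine (secondMoment_eq_expect C.block μ hμ θ _ _ fun k => Or.inl (C.covers k)).trans ?_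
  simp only [prod_labelWeight_kronecker_conjTranspose h1 h0 hM]
  refine (expect_indicator (biasedWalk n q m C.pairs)
    {γ | T ⊆ sSites (γ (Fin.last m))} (1 : ℂ)).trans ?_
  rw [Complex.real_smul, mul_one]

end SecondMoment

end HEA

theorem theorem1_general {n q p m : ℕ} [NeZero q] (C : HEA.Circuit n q p m)
    (μ : Fin m → Measure (Matrix.unitaryGroup (Fin q × Fin q) ℂ)) [∀ t, IsProbabilityMeasure (μ t)]
    (hμ : ∀ t, HEA.IsTwoDesign (μ t)) (ν : Measure (Fin p → ℝ)) [IsProbabilityMeasure ν]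
    {M : Fin n → Matrix (Fin q) (Fin q) ℂ} {T : Set (Fin n)} (h1 : ∀ k ∉ T, M k = 1)
    (h0 : ∀ k ∈ T, (M k).trace = 0) (hM : ∀ k ∈ T, ((M k)ᴴ * M k).trace = q) :
    let walkProb := ((HEA.biasedWalk n q m C.pairs).toOuterMeasure
      {γ | T ⊆ HEA.sSites (γ (Fin.last m))}).toReal
    ∫ V, ∫ θ, ‖C.expval (HEA.tensor M) V θ‖ ^ 2 ∂ν ∂(Measure.pi μ) = walkProb ∧
      ((∀ k, (M k).IsHermitian) →
        ∫ V, ∫ θ, C.expval (HEA.tensor M) V θ ^ 2 ∂ν ∂(Measure.pi μ) = (walkProb : ℂ)) := by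
  intro walkProb
  have hnorm : ∫ V, ∫ θ, ‖C.expval (HEA.tensor M) V θ‖ ^ 2 ∂ν ∂(Measure.pi μ) = walkProb := by
    rw [integral_integral_swap (C.integrable_norm_expval_sq _ _ ν)]
    simp only [C.integral_norm_expval_sq μ hμ h1 h0 hM, integral_const, probReal_univ, one_smul,
      walkProb]
  refine ⟨hnorm, fun hHerm => ?_⟩
  have hX : (HEA.tensor M).IsHermitian := by
    rw [Matrix.IsHermitian, HEA.conjTranspose_tensor]
    simp only [(hHerm _).eq]
  simp only [C.expval_sq_of_isHermitian hX, integral_complex_ofReal, hnorm]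

theorem theorem1 {n q p m : ℕ} [NeZero q]
    (C : HEA.Circuit n q p m)
    (μ : Fin m → MeasureTheory.Measure (Matrix.unitaryGroup (Fin q × Fin q) ℂ))
    [∀ t, MeasureTheory.IsProbabilityMeasure (μ t)]
    (hμ : ∀ t, HEA.IsTwoDesign (μ t))
    (M : Fin (q ^ 2) → Matrix (Fin q) (Fin q) ℂ)
    (hM : HEA.IsOperatorBasis M)
    (x : Fin n → Fin (q ^ 2)) :
    HEA.average μ (fun V (θ : Fin p → ℝ) =>
        ‖C.expval (HEA.tensor fun k => M (x k)) V θ‖ ^ 2) = C.walkProb x ∧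
      ((∀ k, (M k).IsHermitian) →
        HEA.average μ (fun V (θ : Fin p → ℝ) =>
          (C.expval (HEA.tensor fun k => M (x k)) V θ) ^ 2) = (C.walkProb x : ℂ)) := by
  have hx {k : Fin n} (hk : k ∉ HEA.supp x) : x k = 0 := not_not.mp hk
  obtain ⟨hnorm, hsq⟩ := theorem1_general C μ hμ (HEA.uniformParams p) (M := fun k => M (x k))
    (T := HEA.supp x) (fun k hk => by rw [hx hk, hM.zero])
    (fun k hk => by simpa [hM.zero, Ne.symm hk] using hM.trace 0 (x k))
    (fun k _ => by rw [hM.trace, if_pos rfl])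
  exact ⟨hnorm, fun hHerm => hsq fun k => hHerm (x k)⟩
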